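/- Let $G$ be a finite group acting continuously on a Hausdorff aspherical space $T$ (that is, $T$ is nonempty and path-connected, and $\pi_k(T)=0$ for all $k\ge 2$), and let $H\le G$ be a subgroup, acting on $T$ by restriction. Let $\mathbf EG$ (resp. $\mathbf EH$) be a contractible Hausdorff space with a free continuous action of $G$ (resp. $H$); no cell structure is needed. For $K\in\{G,H\}$ let $K$ act diagonally on $T\times\mathbf EK$, let $\iota_K:\pi_1(T)\to\pi_1\bigl((T\times\mathbf EK)/K\bigr)$ be the composite of the natural isomorphism $\pi_1(T)\cong\pi_1(T\times\mathbf EK)$ and the homomorphism induced by the natural projection, and let $\partial_K:\pi_1\bigl((T\times\mathbf EK)/K\bigr)\to K$ be the boundary homomorphism of the covering $T\times\mathbf EK\to(T\times\mathbf EK)/K$ (base points $t\in T$, $e_G\in\mathbf EG$, $e_H\in\mathbf EH$ are fixed, arbitrarily). Put $S_K=\pi_1\bigl((T\times\mathbf EK)/K\bigr)$. The projection $(T\times\mathbf EH\times\mathbf EG)/H\to(T\times\mathbf EH)/H$ induces an isomorphism of fundamental groups, and so there is a natural homomorphism $P_\#:S_H\to S_G$, whose composite with this isomorphism is induced by the projection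 $(T\times\mathbf EH\times\mathbf EG)/H\to(T\times\mathbf EG)/G$. For every $H$-equivariant continuous map $\varphi:\mathbf EH\to\mathbf EG$ with $\varphi(e_H)=e_G$, $P_\#$ is the homomorphism induced by $[t,x]\mapsto[t,\varphi(x)]$; if $\mathbf EH=\mathbf EG$, $e_H=e_G$, with the restricted action, it is induced by the natural projection $(T\times\mathbf EG)/H\to(T\times\mathbf EG)/G$. Moreover: 1. The following diagram is commutative and has exact rows and columns, where $j_1,j_2$ are the projections to the sets of left cosets and the lower row, as well as the ends of the last two columns, are read as sequences of pointed sets if $H$ is not normal in $G$: $$\begin{array}{ccccccccc} &&1&&1&&1&&\\ &&\downarrow&&\downarrow&&\downarrow&&\\ 1&\to&\pi_1(T)&\xrightarrow{\iota_H}&S_H&\xrightarrow{\partial_H}&H&\to&1\\ &&{\scriptstyle\mathrm{id}}\downarrow&&{\scriptstyle P_\#}\downarrow&&\downarrow&&\\ 1&\to&\pi_1(T)&\xrightarrow{\iota_G}&S_G&\xrightarrow{\partial_G}&G&\to&1\\ &&\downarrow&&{\scriptstyle j_1}\downarrow&&{\scriptstyle j_2}\downarrow&&\\ &&1&\to&S_G/P_\#(S_H)&\xrightarrow{j_3}&G/H&\to&1\\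 &&&&\downarrow&&\downarrow&&\\ &&&&1&&1&& \end{array}$$ In particular $P_\#$ is injective. The map $j_3$ is a bijection, and if $H$ is normal in $G$ then $P_\#(S_H)$ is normal in $S_G$ and $j_3$ is an isomorphism of groups. 2. $P_\#(S_H)=\partial_G^{-1}(H)$; its index in $S_G$ is $[G:H]$; and it is normal in $S_G$ if and only if $H$ is normal in $G$. -/

import Mathlib

open scoped Topology

/-- An aspherical space, i.e. an Eilenberg-MacLane space of type `K(π, 1)`: `π_k(T)` is trivial for
all `k ≠ 1`; the case `k = 0` says that `T` is path-connected (and nonempty). -/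
structure IsAspherical (T : Type*) [TopologicalSpace T] : Prop where
  pathConnectedSpace : PathConnectedSpace T
  subsingleton_homotopyGroup : ∀ k : ℕ, 2 ≤ k → ∀ x : T, Subsingleton (π_ k T x)

/-- `1 → A → B → C → 1` is exact, as a sequence of pointed sets with base point `c` of `C`
(with `A → B` honestly injective). For group homomorphisms and `c = 1` this is a short exact
sequence of groups. -/
structure IsShortExact {A B C : Type*} (f : A → B) (g : B → C) (c : C) : Prop where
  injective : Function.Injective f
  exact : ∀ b : B, g b = c ↔ b ∈ Set.range f
  surjective : Function.Surjective g

/-- The Borel construction `(T × E) / G`, the orbit space of the diagonal action. -/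
abbrev BorelQuotient (G T E : Type*) [Group G] [MulAction G T] [MulAction G E] : Type _ :=
  MulAction.orbitRel.Quotient G (T × E)

namespace BorelQuotient

instance {G X : Type*} [Group G] (H : Subgroup G) [TopologicalSpace X] [MulAction G X]
    [ContinuousConstSMul G X] : ContinuousConstSMul H X :=
  ⟨fun h => continuous_const_smul (h : G)⟩

section Basic

variable (G : Type*) {T E : Type*} [Group G] [MulAction G T] [MulAction G E]

/-- The orbit of `(t, e)`. -/
def mk (t : T) (e : E) : BorelQuotient G T E := Quotient.mk (MulAction.orbitRel G (T × E)) (t, e)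

variable [TopologicalSpace T] [TopologicalSpace E]

/-- The map `T → (T × E) / G`, `t ↦ [t, e]`: the inclusion `T → T × {e}` followed by the natural
projection. -/
def fibreMap (e : E) : C(T, BorelQuotient G T E) where
  toFun t := mk G t e
  continuous_toFun := continuous_quotient_mk'.comp (by fun_prop)

/-- The homomorphism `π₁(T) → π₁((T × E) / G)` of the subordinate extension: the natural
identification of `π₁(T)` with `π₁(T × E)` (for contractible `E`) followed by the homomorphism
induced by the natural projection. -/
noncomputable def incl (t : T) (e : E) :
    FundamentalGroup T t →* FundamentalGroup (BorelQuotient G T E) (mk G t e) :=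
  FundamentalGroup.map (fibreMap G e) t

/-- A free action of a finite group on a Hausdorff space `E` makes the projection
`T × E → (T × E) / G` a regular covering with group `G`. -/
theorem isQuotientCoveringMap [Finite G] [T2Space T] [T2Space E] [ContinuousConstSMul G T]
    [ContinuousConstSMul G E] [IsCancelSMul G E] :
    IsQuotientCoveringMap (Quotient.mk (MulAction.orbitRel G (T × E))) G where
  toIsQuotientMap := isQuotientMap_quotient_mk'
  continuous_const_smul := continuous_const_smul
  apply_eq_iff_mem_orbit := Quotient.eq''
  disjoint x := by
    have key : ∀ g : G, ∃ U ∈ 𝓝 x, ((g • ·) '' U ∩ U).Nonempty → g = 1 := by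
      intro g
      by_cases hg : g = 1
      · exact ⟨Set.univ, Filter.univ_mem, fun _ => hg⟩
      · have hne : g • x ≠ x := fun h => hg <|
          IsCancelSMul.right_cancel g 1 x.2 (by rw [one_smul]; exact congrArg Prod.snd h)
        obtain ⟨V, W, hV, hW, hxV, hxW, hVW⟩ := t2_separation hne
        refine ⟨(g • ·) ⁻¹' V ∩ W, Filter.inter_mem
          ((hV.preimage (continuous_const_smul g)).mem_nhds hxV) (hW.mem_nhds hxW), ?_⟩
        rintro ⟨_, ⟨y, hy, rfl⟩, hz⟩
        exact (Set.disjoint_left.mp hVW hy.1 hz.2).elim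
    choose U hU hUg using key
    refine ⟨⋂ g, U g, Filter.iInter_mem.mpr hU, fun g hg => hUg g (hg.mono ?_)⟩
    exact Set.inter_subset_inter (Set.image_mono (Set.iInter_subset U g))
      (Set.iInter_subset U g)

/-- The boundary homomorphism `∂ : π₁((T × E) / G) → G` of the covering `T × E → (T × E) / G`:
the lift of `γ` that ends at `(t, e)` starts at `∂ γ • (t, e)`; equivalently, the lift of `γ` that
starts at `(t, e)` ends at `(∂ γ)⁻¹ • (t, e)`. (In `FundamentalGroup` the product `γ * γ'` is the
loop `γ'` followed by the loop `γ`; therefore the inverse is needed to get a homomorphism.) -/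
noncomputable def boundary [Finite G] [T2Space T] [T2Space E] [ContinuousConstSMul G T]
    [ContinuousConstSMul G E] [IsCancelSMul G E] (t : T) (e : E) :
    FundamentalGroup (BorelQuotient G T E) (mk G t e) →* G :=
  (MulEquiv.inv' G).symm.toMonoidHom.comp
    ((isQuotientCoveringMap G).fundamentalGroupToMulOpposite ⟨(t, e), rfl⟩)

end Basic

/-- The map `(T × E) / K → (T × E') / G`, `[t, x] ↦ [t, f x]`, induced by a continuous map
`f : E → E'` that is equivariant along a homomorphism `ρ : K → G`, where `K` acts on `T`
through `ρ`. -/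
def map {K G T E E' : Type*} [Group K] [Group G] [MulAction K T] [MulAction G T]
    [MulAction K E] [MulAction G E'] [TopologicalSpace T] [TopologicalSpace E]
    [TopologicalSpace E'] (ρ : K →* G) (hρ : ∀ (k : K) (t : T), ρ k • t = k • t)
    (f : C(E, E')) (hf : ∀ (k : K) (x : E), f (k • x) = ρ k • f x) :
    C(BorelQuotient K T E, BorelQuotient G T E') where
  toFun := Quotient.lift (fun p : T × E => mk G p.1 (f p.2)) (by
    rintro _ b ⟨k, rfl⟩
    exact Quotient.sound ⟨ρ k, Prod.ext (hρ k b.1) (hf k b.2).symm⟩)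
  continuous_toFun := Continuous.quotient_lift (continuous_quotient_mk'.comp (by fun_prop)) _

section Subgroup

variable {G : Type*} [Group G] (H : Subgroup G) (T : Type*) {EG EH : Type*}
  [MulAction G T] [MulAction G EG] [MulAction H EH]
  [TopologicalSpace T] [TopologicalSpace EG] [TopologicalSpace EH]

/-- The natural map `(T × EH) / H → (T × EG) / G`, `[t, x] ↦ [t, φ x]`, for an `H`-equivariant map
`φ : EH → EG`. For `EH = EG` and `φ = id` it is the natural projection
`(T × EG) / H → (T × EG) / G`. -/
def ofEquivariant (φ : C(EH, EG)) (hφ : ∀ (h : H) (x : EH), φ (h • x) = h • φ x) :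
    C(BorelQuotient H T EH, BorelQuotient G T EG) :=
  map H.subtype (fun _ _ => rfl) φ hφ

/-- The map `(T × (EH × EG)) / H → (T × EH) / H` that forgets the coordinate in `EG`. -/
def proj₁ : C(BorelQuotient H T (EH × EG), BorelQuotient H T EH) :=
  map (MonoidHom.id H) (fun _ _ => rfl) ⟨Prod.fst, continuous_fst⟩ (fun _ _ => rfl)

/-- The map `(T × (EH × EG)) / H → (T × EG) / G` that forgets the coordinate in `EH`. -/
def proj₂ : C(BorelQuotient H T (EH × EG), BorelQuotient G T EG) :=
  ofEquivariant H T ⟨Prod.snd, continuous_snd⟩ (fun _ _ => rfl)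

end Subgroup

end BorelQuotient

/-! A free action of a finite group `K` on a Hausdorff space is a covering action, so `T × E → (T ×
E)/K` has a monodromy sequence; since `E` is simply connected, this sequence is an extension of `K`
by `π₁(T)` (`isShortExact_incl_boundary`). It is natural for maps equivariant along a homomorphism
of groups (`map_incl`, `boundary_map`).

Both projections from `(T × (EH × EG))/H` are therefore morphisms of extensions that are the
identity on `π₁(T)`. On the quotient groups `proj₁` gives the identity of `H`, so it is an
isomorphism on `π₁` by the short five lemma, and `proj₂` gives the inclusion `H → G`. Hence `P_# =
(proj₂)_* ∘ (proj₁)_*⁻¹` is a morphism of extensions over `H → G`. Injectivity, the image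
`∂_G⁻¹(H)`, the coset bijection, index and normality follow by diagram chasing. -/

theorem FundamentalGroup.mapOfEq_rfl {X Y : Type*} [TopologicalSpace X] [TopologicalSpace Y]
    (f : C(X, Y)) (x : X) : FundamentalGroup.mapOfEq f (rfl : f x = f x) =
      FundamentalGroup.map f x := by
  ext p
  rw [FundamentalGroup.mapOfEq_apply, Path.Homotopic.Quotient.cast_rfl_rfl]
  rfl

theorem FundamentalGroup.map_map {X Y Z : Type*} [TopologicalSpace X] [TopologicalSpace Y]
    [TopologicalSpace Z] (g : C(Y, Z)) (f : C(X, Y)) (x : X) (p : FundamentalGroup X x) :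
    FundamentalGroup.map g (f x) (FundamentalGroup.map f x p) =
      FundamentalGroup.map (g.comp f) x p :=
  Path.Homotopic.Quotient.map_comp.symm

theorem FundamentalGroup.map_id_apply {X : Type*} [TopologicalSpace X] (x : X)
    (p : FundamentalGroup X x) : FundamentalGroup.map (ContinuousMap.id X) x p = p := by
  induction p using Path.Homotopic.Quotient.ind
  rfl

/-- Monodromy is natural with respect to maps of covering spaces. -/
theorem IsCoveringMap.monodromy_map_apply {A A' X X' : Type*} [TopologicalSpace A]
    [TopologicalSpace A'] [TopologicalSpace X] [TopologicalSpace X'] {p : A → X} {p' : A' → X'}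
    (cov : IsCoveringMap p) (cov' : IsCoveringMap p') (F : C(A, A')) (f : C(X, X'))
    (h : ∀ a, p' (F a) = f (p a)) {x y : X} (γ : Path.Homotopic.Quotient x y) (a : p ⁻¹' {x}) :
    cov'.monodromy (γ.map f) ⟨F a, (h a).trans (congrArg f a.2)⟩ =
      ⟨F (cov.monodromy γ a), (h _).trans (congrArg f (cov.monodromy γ a).2)⟩ := by
  -- `F` applied to the lift of `γ` is a lift of `f ∘ γ`, and its endpoint computes the monodromy.
  refine cov'.monodromy_eq_of_map_eq
    (ey := ⟨F (cov.monodromy γ a), (h _).trans (congrArg f (cov.monodromy γ a).2)⟩)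
    ((cov.liftPathQuotient γ a).map F) ?_
  have hF : (⟨p', cov'.continuous⟩ : C(A', X')).comp F = f.comp ⟨p, cov.continuous⟩ :=
    ContinuousMap.ext h
  have key := congrArg (fun q => q.map f) (cov.map_liftPathQuotient γ a)
  simp only [← Path.Homotopic.Quotient.map_comp] at key ⊢
  obtain ⟨δ, hδ⟩ : ∃ δ, cov.liftPathQuotient γ a = .mk δ :=
    ⟨_, (Quotient.exists_rep _).choose_spec.symm⟩
  obtain ⟨ε⟩ := γ
  rw [hδ] at key ⊢
  refine Eq.trans ?_ (congrArg (fun q => q.cast (h _) (h _)) key)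
  refine congrArg Path.Homotopic.Quotient.mk ?_
  ext s
  exact h _

/-- A group element is determined by where it moves the base point of the fibre; equivariance of `F`
and naturality of monodromy identify the two translates. -/
theorem IsQuotientCoveringMap.fundamentalGroupToMulOpposite_map {A A' X X' K G : Type*}
    [TopologicalSpace A] [TopologicalSpace A'] [TopologicalSpace X] [TopologicalSpace X']
    [Group K] [Group G] [MulAction K A] [MulAction G A'] {p : A → X} {p' : A' → X'}
    (hp : IsQuotientCoveringMap p K) (hp' : IsQuotientCoveringMap p' G) (ρ : K →* G)
    (F : C(A, A')) (hF : ∀ (k : K) (a : A), F (k • a) = ρ k • F a) (f : C(X, X'))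
    (h : ∀ a, p' (F a) = f (p a)) {x : X} (a : p ⁻¹' {x}) (γ : FundamentalGroup X x) :
    (hp'.fundamentalGroupToMulOpposite ⟨F a, (h a).trans (congrArg f a.2)⟩
      (FundamentalGroup.map f x γ)).unop = ρ (hp.fundamentalGroupToMulOpposite a γ).unop := by
  have := (hp'.fundamentalGroupToMulOpposite_apply_eq_Iff
    (e := ⟨F a, (h a).trans (congrArg f a.2)⟩) (γ := FundamentalGroup.map f x γ)
    (g := .op (ρ (hp.fundamentalGroupToMulOpposite a γ).unop))).2 ?_
  · rw [this]; rfl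
  · rw [MulOpposite.unop_op, ← hF, hp.unop_fundamentalGroupToMulOpposite_smul]
    exact (congrArg Subtype.val
      (hp.isCoveringMap.monodromy_map_apply hp'.isCoveringMap F f h γ a)).symm

theorem IsQuotientCoveringMap.fundamentalGroupToMulOpposite_eq_one_iff_mem_range {A X G : Type*}
    [TopologicalSpace A] [TopologicalSpace X] [Group G] [MulAction G A] {p : A → X}
    (hp : IsQuotientCoveringMap p G) (a : A) (γ : FundamentalGroup X (p a)) :
    hp.fundamentalGroupToMulOpposite ⟨a, rfl⟩ γ = 1 ↔
      γ ∈ (FundamentalGroup.map ⟨p, hp.continuous⟩ a).range := by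
  rw [← MonoidHom.mem_ker, hp.ker_fundamentalGroupToMulOpposite,
    hp.ker_monodromyPerm ⟨a, rfl⟩]
  exact Eq.to_iff (congrArg (fun q => γ ∈ MonoidHom.range q)
    (FundamentalGroup.mapOfEq_rfl ⟨p, hp.continuous⟩ a))

/-! ### Morphisms of group extensions and cosets -/

namespace IsShortExact

variable {A B B' C C' : Type*} [Group A] [Group B] [Group B'] [Group C] [Group C']
  {i : A →* B} {d : B →* C} {i' : A →* B'} {d' : B' →* C'} {P : B →* B'} {ρ : C →* C'}

theorem injective_of_comm (h : IsShortExact i d 1) (h' : IsShortExact i' d' 1)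
    (hi : ∀ a, P (i a) = i' a) (hd : ∀ b, d' (P b) = ρ (d b)) (hρ : Function.Injective ρ) :
    Function.Injective P := by
  refine (injective_iff_map_eq_one P).2 fun b hb => ?_
  have hdb : d b = 1 := hρ (by rw [← hd, hb, map_one, map_one])
  obtain ⟨a, rfl⟩ := (h.exact b).1 hdb
  have ha : a = 1 := h'.injective (by rw [← hi, hb, map_one])
  rw [ha, map_one]

theorem range_eq_comap_of_comm (h : IsShortExact i d 1) (h' : IsShortExact i' d' 1)
    (hi : ∀ a, P (i a) = i' a) (hd : ∀ b, d' (P b) = ρ (d b)) :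
    P.range = ρ.range.comap d' := by
  ext y
  constructor
  · rintro ⟨b, rfl⟩
    exact ⟨d b, (hd b).symm⟩
  · rintro ⟨c, hc⟩
    obtain ⟨b, rfl⟩ := h.surjective c
    -- `P b` and `y` have the same image under `d'`, so they differ by an element of the common
    -- kernel, which `P` reaches through `i`.
    obtain ⟨a, ha⟩ := (h'.exact ((P b)⁻¹ * y)).1 (by rw [map_mul, map_inv, hd, hc, inv_mul_cancel])
    exact ⟨b * i a, by rw [map_mul, hi, ha, mul_inv_cancel_left]⟩

theorem bijective_of_comm (h : IsShortExact i d 1) (h' : IsShortExact i' d' 1)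
    (hi : ∀ a, P (i a) = i' a) (hd : ∀ b, d' (P b) = ρ (d b)) (hρ : Function.Bijective ρ) :
    Function.Bijective P := by
  refine ⟨h.injective_of_comm h' hi hd hρ.1, MonoidHom.range_eq_top.1 ?_⟩
  rw [h.range_eq_comap_of_comm h' hi hd, MonoidHom.range_eq_top.2 hρ.2, Subgroup.comap_top]

end IsShortExact

/-- The inclusion of a subgroup and the projection to its left cosets are exact as pointed sets. -/
theorem isShortExact_mk {A B : Type*} [Group A] [Group B] {f : A →* B}
    (hf : Function.Injective f) :
    IsShortExact f (fun y => (y : B ⧸ f.range)) ((1 : B) : B ⧸ f.range) where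
  injective := hf
  exact b := by
    rw [eq_comm, QuotientGroup.eq, inv_one, one_mul]
    rfl
  surjective := QuotientGroup.mk_surjective

theorem Subgroup.isShortExact_subtype {G : Type*} [Group G] (H : Subgroup G) :
    IsShortExact H.subtype (fun g => (g : G ⧸ H)) ((1 : G) : G ⧸ H) where
  injective := H.subtype_injective
  exact b := by
    rw [eq_comm, QuotientGroup.eq, inv_one, one_mul, Subgroup.coe_subtype, Subtype.range_coe]
    rfl
  surjective := QuotientGroup.mk_surjective

/-- A surjective homomorphism induces a bijection from the left cosets of the preimage of a
subgroup to the left cosets of the subgroup. -/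
theorem Subgroup.exists_bijective_quotient_comap {S G : Type*} [Group S] [Group G] {d : S →* G}
    (hd : Function.Surjective d) {H : Subgroup G} {N : Subgroup S} (hN : N = H.comap d) :
    ∃ j : S ⧸ N → G ⧸ H, (∀ y : S, j y = (d y : G ⧸ H)) ∧ Function.Bijective j := by
  subst hN
  have key (a b : S) : (a : S ⧸ H.comap d) = b ↔ (d a : G ⧸ H) = d b := by
    rw [QuotientGroup.eq, QuotientGroup.eq, Subgroup.mem_comap, map_mul, map_inv]
  refine ⟨Quotient.lift (fun y => (d y : G ⧸ H))
    fun a b hab => (key a b).1 (Quotient.sound hab), fun _ => rfl, ?_, fun c => ?_⟩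
  · rintro ⟨a⟩ ⟨b⟩ hab
    exact (key a b).2 hab
  · obtain ⟨g, rfl⟩ := QuotientGroup.mk_surjective c
    obtain ⟨y, rfl⟩ := hd g
    exact ⟨y, rfl⟩

/-! ### The extension of a Borel construction and its naturality -/

namespace BorelQuotient

section Naturality

variable {K G T E E' : Type*} [Group K] [Group G] [MulAction K T] [MulAction G T]
  [MulAction K E] [MulAction G E'] [TopologicalSpace T] [TopologicalSpace E] [TopologicalSpace E']
  (ρ : K →* G) (hρ : ∀ (k : K) (t : T), ρ k • t = k • t)
  (f : C(E, E')) (hf : ∀ (k : K) (x : E), f (k • x) = ρ k • f x)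

theorem map_incl (t : T) (e : E) (a : FundamentalGroup T t) :
    FundamentalGroup.map (map ρ hρ f hf) (mk K t e) (incl K t e a) = incl G t (f e) a :=
  FundamentalGroup.map_map (map ρ hρ f hf) (fibreMap K e) t a

theorem boundary_map [Finite K] [Finite G] [T2Space T] [T2Space E] [T2Space E']
    [ContinuousConstSMul K T] [ContinuousConstSMul G T] [ContinuousConstSMul K E]
    [ContinuousConstSMul G E'] [IsCancelSMul K E] [IsCancelSMul G E'] (t : T) (e : E)
    (x : FundamentalGroup (BorelQuotient K T E) (mk K t e)) :
    boundary G t (f e) (FundamentalGroup.map (map ρ hρ f hf) (mk K t e) x) =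
      ρ (boundary K t e x) := by
  refine Eq.trans (congrArg Inv.inv <|
    (isQuotientCoveringMap (T := T) (E := E) K).fundamentalGroupToMulOpposite_map
    (isQuotientCoveringMap (T := T) (E := E') G) ρ ((ContinuousMap.id T).prodMap f)
    (fun k a => Prod.ext (hρ k a.1).symm (hf k a.2)) (map ρ hρ f hf) (fun _ => rfl)
    ⟨(t, e), rfl⟩ x) (map_inv ρ _).symm

end Naturality

theorem isShortExact_incl_boundary (G : Type*) {T E : Type*} [Group G] [Finite G] [MulAction G T]
    [MulAction G E] [TopologicalSpace T] [TopologicalSpace E] [T2Space T] [T2Space E]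
    [ContinuousConstSMul G T] [ContinuousConstSMul G E] [IsCancelSMul G E]
    [PathConnectedSpace T] [SimplyConnectedSpace E] (t : T) (e : E) :
    IsShortExact (incl G t e) (boundary G t e) 1 := by
  have hp := isQuotientCoveringMap (T := T) (E := E) G
  let p : C(T × E, BorelQuotient G T E) := ⟨_, hp.continuous⟩
  let s : C(T, T × E) := ⟨fun x => (x, e), by fun_prop⟩
  have hincl (a) : incl G t e a = FundamentalGroup.map p (t, e) (FundamentalGroup.map s t a) :=
    (FundamentalGroup.map_map p s t a).symm
  have hfst (a : FundamentalGroup T t) :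
      FundamentalGroup.map (⟨Prod.fst, continuous_fst⟩ : C(T × E, T)) (t, e)
        (FundamentalGroup.map s t a) = a :=
    (FundamentalGroup.map_map _ s t a).trans (FundamentalGroup.map_id_apply t a)
  -- A class in a product is determined by its two projections, and the one in `E` is trivial by
  -- simple connectivity.
  have hs : Function.Surjective (FundamentalGroup.map s t) := fun b => by
    refine ⟨FundamentalGroup.map (⟨Prod.fst, continuous_fst⟩ : C(T × E, T)) (t, e) b, ?_⟩
    have h1 := hfst (FundamentalGroup.map (⟨Prod.fst, continuous_fst⟩ : C(T × E, T)) (t, e) b)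
    refine (Path.Homotopic.prod_projLeft_projRight (a₁ := t) (b₁ := e) (a₂ := t) (b₂ := e) _).symm.trans
      (Eq.trans ?_ (Path.Homotopic.prod_projLeft_projRight (a₁ := t) (b₁ := e) (a₂ := t) (b₂ := e) b))
    exact congrArg₂ Path.Homotopic.prod h1 (Subsingleton.elim (α := Path.Homotopic.Quotient e e) _ _)
  refine ⟨fun a b hab => ?_, fun b => ?_, fun g => ?_⟩
  · rw [hincl, hincl] at hab
    have := hp.isCoveringMap.injective_path_homotopic_map (t, e) (t, e) hab
    rw [← hfst a, ← hfst b]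
    exact congrArg _ this
  · have h1 : boundary G t e b = 1 ↔ hp.fundamentalGroupToMulOpposite ⟨(t, e), rfl⟩ b = 1 :=
      inv_eq_one.trans (MulOpposite.unop_eq_one_iff _)
    refine (h1.trans (hp.fundamentalGroupToMulOpposite_eq_one_iff_mem_range (t, e) b)).trans ?_
    constructor
    · rintro ⟨c, rfl⟩
      obtain ⟨a, rfl⟩ := hs c
      exact ⟨a, hincl a⟩
    · rintro ⟨a, rfl⟩
      exact ⟨_, (hincl a).symm⟩
  -- Path-connectedness of `T × E` makes monodromy surjective; `g⁻¹` compensates the inverse in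
  -- `boundary`.
  · obtain ⟨x, hx⟩ := hp.fundamentalGroupToMulOpposite_surjective ⟨(t, e), rfl⟩ (.op g⁻¹)
    refine ⟨x, ?_⟩
    refine Eq.trans (congrArg (fun y : Gᵐᵒᵖ => y.unop⁻¹) hx) (inv_inv g)

end BorelQuotient

namespace BorelQuotient

/-- Forgetting a contractible free factor of the fibre does not change the fundamental group. -/
theorem bijective_map_proj₁ {G : Type*} [Group G] [Finite G] (H : Subgroup G) {T EG EH : Type*}
    [TopologicalSpace T] [T2Space T] [PathConnectedSpace T]
    [MulAction G T] [ContinuousConstSMul G T]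
    [TopologicalSpace EG] [T2Space EG] [ContractibleSpace EG]
    [MulAction G EG] [ContinuousConstSMul G EG]
    [TopologicalSpace EH] [T2Space EH] [ContractibleSpace EH]
    [MulAction H EH] [ContinuousConstSMul H EH] [IsCancelSMul H EH] (t : T) (eG : EG) (eH : EH) :
    Function.Bijective
      (FundamentalGroup.map (proj₁ H T (EH := EH) (EG := EG)) (mk H t (eH, eG))) := by
  -- Freeness on the factor `EH` suffices.
  have : IsCancelSMul H (EH × EG) :=
    ⟨fun g h x hx => IsCancelSMul.right_cancel g h x.1 (congrArg Prod.fst hx)⟩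
  exact (isShortExact_incl_boundary H t (eH, eG)).bijective_of_comm
    (isShortExact_incl_boundary H t eH)
    (P := FundamentalGroup.map (proj₁ H T (EH := EH) (EG := EG)) (mk H t (eH, eG)))
    (map_incl (MonoidHom.id H) (fun _ _ => rfl) ⟨Prod.fst, continuous_fst⟩ (fun _ _ => rfl) t
      (eH, eG))
    (boundary_map (MonoidHom.id H) (fun _ _ => rfl) ⟨Prod.fst, continuous_fst⟩ (fun _ _ => rfl) t
      (eH, eG))
    Function.bijective_id

end BorelQuotient

/-! ### The commutative diagram -/

theorem mainTheorem6 {G : Type*} [Group G] [Finite G] (H : Subgroup G)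
    {T : Type*} [TopologicalSpace T] [T2Space T] (hT : IsAspherical T)
    [MulAction G T] [ContinuousConstSMul G T]
    {EG : Type*} [TopologicalSpace EG] [T2Space EG] [ContractibleSpace EG]
    [MulAction G EG] [ContinuousConstSMul G EG] [IsCancelSMul G EG]
    {EH : Type*} [TopologicalSpace EH] [T2Space EH] [ContractibleSpace EH]
    [MulAction H EH] [ContinuousConstSMul H EH] [IsCancelSMul H EH]
    (t : T) (eG : EG) (eH : EH) :
    -- the natural map `P_#`, as the map induced by `(T × EH)/H ← (T × EH × EG)/H → (T × EG)/G`
    Function.Bijective (FundamentalGroup.map (BorelQuotient.proj₁ H T (EH := EH) (EG := EG))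
      (BorelQuotient.mk H t (eH, eG))) ∧
    ∃ P : FundamentalGroup (BorelQuotient H T EH) (BorelQuotient.mk H t eH) →*
        FundamentalGroup (BorelQuotient G T EG) (BorelQuotient.mk G t eG),
      (∀ x : FundamentalGroup (BorelQuotient H T (EH × EG)) (BorelQuotient.mk H t (eH, eG)),
        P (FundamentalGroup.map (BorelQuotient.proj₁ H T) (BorelQuotient.mk H t (eH, eG)) x) =
          FundamentalGroup.map (BorelQuotient.proj₂ H T) (BorelQuotient.mk H t (eH, eG)) x) ∧
      (∀ (φ : C(EH, EG)) (hφ : ∀ (h : H) (x : EH), φ (h • x) = h • φ x) (he : φ eH = eG),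
        P = FundamentalGroup.mapOfEq (BorelQuotient.ofEquivariant H T φ hφ)
          (show BorelQuotient.ofEquivariant H T φ hφ (BorelQuotient.mk H t eH) = BorelQuotient.mk G t eG from
            congrArg (BorelQuotient.mk G t) he)) ∧
      -- the two upper rows
      IsShortExact (BorelQuotient.incl H t eH) (BorelQuotient.boundary H t eH) 1 ∧
      IsShortExact (BorelQuotient.incl G t eG) (BorelQuotient.boundary G t eG) 1 ∧
      -- the three columns
      IsShortExact (id : FundamentalGroup T t → FundamentalGroup T t) (fun _ => ()) () ∧
      IsShortExact P (fun y => (y : FundamentalGroup (BorelQuotient G T EG) (BorelQuotient.mk G t eG) ⧸ P.range))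
        ((1 : FundamentalGroup (BorelQuotient G T EG) (BorelQuotient.mk G t eG)) :
          FundamentalGroup (BorelQuotient G T EG) (BorelQuotient.mk G t eG) ⧸ P.range) ∧
      IsShortExact H.subtype (fun g => (g : G ⧸ H)) ((1 : G) : G ⧸ H) ∧
      -- the two upper squares and the lower left square commute
      (∀ a, P (BorelQuotient.incl H t eH a) = BorelQuotient.incl G t eG a) ∧
      (∀ x, BorelQuotient.boundary G t eG (P x) = (BorelQuotient.boundary H t eH x : G)) ∧
      (∀ a, (BorelQuotient.incl G t eG a :
          FundamentalGroup (BorelQuotient G T EG) (BorelQuotient.mk G t eG) ⧸ P.range) =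
        (1 : FundamentalGroup (BorelQuotient G T EG) (BorelQuotient.mk G t eG))) ∧
      -- the lower right square commutes and the lower row is exact, with `j₃` even bijective
      (∃ j₃ : FundamentalGroup (BorelQuotient G T EG) (BorelQuotient.mk G t eG) ⧸ P.range → G ⧸ H,
        (∀ y : FundamentalGroup (BorelQuotient G T EG) (BorelQuotient.mk G t eG),
          j₃ y = (BorelQuotient.boundary G t eG y : G ⧸ H)) ∧
        IsShortExact (fun _ : Unit =>
            ((1 : FundamentalGroup (BorelQuotient G T EG) (BorelQuotient.mk G t eG)) :
              FundamentalGroup (BorelQuotient G T EG) (BorelQuotient.mk G t eG) ⧸ P.range))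
          j₃ ((1 : G) : G ⧸ H) ∧
        Function.Bijective j₃) ∧
      -- for normal `H` the lower row consists of groups and `j₃` is an isomorphism of groups
      (∀ _ : H.Normal, ∃ _ : P.range.Normal,
        ∃ J₃ : FundamentalGroup (BorelQuotient G T EG) (BorelQuotient.mk G t eG) ⧸ P.range ≃* G ⧸ H,
          ∀ y : FundamentalGroup (BorelQuotient G T EG) (BorelQuotient.mk G t eG),
            J₃ y = (BorelQuotient.boundary G t eG y : G ⧸ H)) ∧
      -- the image of `P_#`
      P.range = H.comap (BorelQuotient.boundary G t eG) ∧
      P.range.index = H.index ∧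
      (P.range.Normal ↔ H.Normal) := by
  have := hT.pathConnectedSpace
  have hcancel : IsCancelSMul H (EH × EG) :=
    ⟨fun g h x hx => IsCancelSMul.right_cancel g h x.1 (congrArg Prod.fst hx)⟩
  have hbij := BorelQuotient.bijective_map_proj₁ H t eG eH
  let Q := MulEquiv.ofBijective _ hbij
  let P : FundamentalGroup (BorelQuotient H T EH) (BorelQuotient.mk H t eH) →*
      FundamentalGroup (BorelQuotient G T EG) (BorelQuotient.mk G t eG) :=
    (FundamentalGroup.map (BorelQuotient.proj₂ H T) (BorelQuotient.mk H t (eH, eG))).comp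
      Q.symm.toMonoidHom
  have hP (x) : P (FundamentalGroup.map (BorelQuotient.proj₁ H T)
      (BorelQuotient.mk H t (eH, eG)) x) = FundamentalGroup.map (BorelQuotient.proj₂ H T)
        (BorelQuotient.mk H t (eH, eG)) x :=
    congrArg (FundamentalGroup.map (BorelQuotient.proj₂ H T) (BorelQuotient.mk H t (eH, eG)))
      (Q.symm_apply_apply x)
  have hH := BorelQuotient.isShortExact_incl_boundary H t eH
  have hG := BorelQuotient.isShortExact_incl_boundary G t eG
  have hi (a) : P (BorelQuotient.incl H t eH a) = BorelQuotient.incl G t eG a := by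
    have h1 := BorelQuotient.map_incl (MonoidHom.id H) (fun _ _ => rfl)
      (⟨Prod.fst, continuous_fst⟩ : C(EH × EG, EH)) (fun _ _ => rfl) t (eH, eG) a
    have h2 := BorelQuotient.map_incl H.subtype (fun _ _ => rfl)
      (⟨Prod.snd, continuous_snd⟩ : C(EH × EG, EG)) (fun _ _ => rfl) t (eH, eG) a
    exact (congrArg P h1).symm.trans ((hP _).trans h2)
  have hd (x) : BorelQuotient.boundary G t eG (P x) = (BorelQuotient.boundary H t eH x : G) := by
    obtain ⟨y, rfl⟩ := hbij.2 x
    have h1 := BorelQuotient.boundary_map (MonoidHom.id H) (fun _ _ => rfl)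
      (⟨Prod.fst, continuous_fst⟩ : C(EH × EG, EH)) (fun _ _ => rfl) t (eH, eG) y
    have h2 := BorelQuotient.boundary_map H.subtype (fun _ _ => rfl)
      (⟨Prod.snd, continuous_snd⟩ : C(EH × EG, EG)) (fun _ _ => rfl) t (eH, eG) y
    exact (congrArg (BorelQuotient.boundary G t eG) (hP y)).trans
      (h2.trans (congrArg Subtype.val h1.symm))
  have hinj := hH.injective_of_comm hG hi hd H.subtype_injective
  have hrange : P.range = H.comap (BorelQuotient.boundary G t eG) := by
    rw [hH.range_eq_comap_of_comm (ρ := H.subtype) hG hi hd, H.range_subtype]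
  have hnormal : P.range.Normal ↔ H.Normal := by
    rw [hrange, Subgroup.normal_comap_iff_of_surjective hG.surjective]
  obtain ⟨j, hj, hjbij⟩ := Subgroup.exists_bijective_quotient_comap hG.surjective hrange
  refine ⟨hbij, P, hP, fun φ hφ he => ?_, hH, hG, ⟨Function.injective_id, fun b => by simp,
    fun _ => ⟨1, rfl⟩⟩, isShortExact_mk hinj, H.isShortExact_subtype, hi, hd, fun a => ?_,
    ⟨j, hj, ⟨fun _ _ _ => rfl, fun b => ?_, hjbij.2⟩, hjbij⟩, fun hN => ?_, hrange, ?_, hnormal⟩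
  · subst he
    -- The graph of `φ` gives a section of `proj₁` whose composite with `proj₂` is the map induced
    -- by `φ`; so `s` induces the inverse of `(proj₁)_*`.
    let s : C(BorelQuotient H T EH, BorelQuotient H T (EH × EG)) :=
      BorelQuotient.map (MonoidHom.id H) (fun _ _ => rfl) ((ContinuousMap.id EH).prodMk φ)
        (fun h x => Prod.ext rfl (hφ h x))
    have hs₁ : (BorelQuotient.proj₁ H T).comp s = ContinuousMap.id _ := by
      ext ⟨x⟩
      rfl
    have hs₂ : (BorelQuotient.proj₂ H T).comp s = BorelQuotient.ofEquivariant H T φ hφ := by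
      ext ⟨x⟩
      rfl
    refine MonoidHom.ext fun y => ?_
    have h1 : FundamentalGroup.map (BorelQuotient.proj₁ H T) (BorelQuotient.mk H t (eH, φ eH))
        (FundamentalGroup.map s (BorelQuotient.mk H t eH) y) = y := by
      -- The type of the induced class mentions the base point `f _`, so replacing `f` by an equal
      -- map goes through heterogeneous equality.
      have h2 (f : C(BorelQuotient H T EH, BorelQuotient H T EH)) (hf : f = ContinuousMap.id _) :
          FundamentalGroup.map f (BorelQuotient.mk H t eH) y ≍ y := by
        subst hf
        exact heq_of_eq (FundamentalGroup.map_id_apply _ y)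
      exact eq_of_heq ((heq_of_eq (FundamentalGroup.map_map (BorelQuotient.proj₁ H T) s
        (BorelQuotient.mk H t eH) y)).trans (h2 _ hs₁))
    have h3 : FundamentalGroup.map (BorelQuotient.proj₂ H T) (BorelQuotient.mk H t (eH, φ eH))
        (FundamentalGroup.map s (BorelQuotient.mk H t eH) y) =
        FundamentalGroup.map (BorelQuotient.ofEquivariant H T φ hφ)
          (BorelQuotient.mk H t eH) y := by
      have h4 (f : C(BorelQuotient H T EH, BorelQuotient G T EG))
          (hf : f = BorelQuotient.ofEquivariant H T φ hφ) :
          FundamentalGroup.map f (BorelQuotient.mk H t eH) y ≍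
            FundamentalGroup.map (BorelQuotient.ofEquivariant H T φ hφ)
              (BorelQuotient.mk H t eH) y := by
        subst hf
        rfl
      exact eq_of_heq ((heq_of_eq (FundamentalGroup.map_map (BorelQuotient.proj₂ H T) s
        (BorelQuotient.mk H t eH) y)).trans (h4 _ hs₂))
    refine (congrArg P h1).symm.trans ((hP _).trans (h3.trans ?_))
    exact (DFunLike.congr_fun (FundamentalGroup.mapOfEq_rfl
      (BorelQuotient.ofEquivariant H T φ hφ) (BorelQuotient.mk H t eH)) y).symm
  · rw [eq_comm, QuotientGroup.eq, inv_one, one_mul, ← hi]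
    exact ⟨_, rfl⟩
  · have h1 : j ((1 : FundamentalGroup (BorelQuotient G T EG) (BorelQuotient.mk G t eG)) :
        FundamentalGroup (BorelQuotient G T EG) (BorelQuotient.mk G t eG) ⧸ P.range) =
        ((1 : G) : G ⧸ H) := by rw [hj, map_one]
    rw [← h1, hjbij.1.eq_iff, Set.range_const, Set.mem_singleton_iff]
  · have hPN := hnormal.2 hN
    refine ⟨hPN, MulEquiv.ofBijective (MonoidHom.mk' j ?_) hjbij, hj⟩
    rintro ⟨a⟩ ⟨b⟩
    exact (hj (a * b)).trans ((congrArg _ (map_mul _ a b)).trans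
      (congrArg₂ (· * ·) (hj a) (hj b)).symm)
  · rw [hrange, Subgroup.index_comap_of_surjective H hG.surjective]
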